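/- A \emph{strict PSI-algebra} is a Boolean algebra $(A,\vee,\wedge,\neg,0,1)$ together with a ternary operation $\Diamond$ such that, for all elements, $\Diamond(0,b,c)=\Diamond(a,0,c)=\Diamond(a,b,0)=0$; $\Diamond(a\vee x,b,c)=\Diamond(a,b,c)\vee\Diamond(x,b,c)$; $\Diamond(a,b\vee x,c)=\Diamond(a,b,c)\vee\Diamond(a,x,c)$; $\Diamond(a,b,c)\vee\Diamond(a,b,x)\le\Diamond(a,b,c\vee x)$; $\Diamond(a,b,f)\le\Diamond(a,b,\neg d)\vee\Diamond(a,b,\neg e)\vee\Diamond(d,e,f)$; $\Diamond(a,b,\neg a)=0$; $a\wedge f\le\Diamond(a,a,f)$; $\Diamond(a,b,f)\le\Diamond(b,a,f)$; $\Diamond(x,y,a)\wedge\neg\Diamond(x,y,b)\le\Diamond(1,1,a\wedge\neg b)$; $\Diamond(x,a,y)\wedge\neg\Diamond(x,b,y)\le\Diamond(1,a\wedge\neg b,1)$; $\Diamond(a,b,c)\le\mu(\Diamond(a,b,c))$, where $\mu(z)=\neg\Diamond(1,1,\neg z)\wedge\neg\Diamond(1,\neg z,1)$. Let $\mathcal{SPSI}$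 be the variety of strict PSI-algebras, in the language $\{\vee,\wedge,\neg,0,1,\Diamond\}$. Then: (1) $\mathcal{SPSI}$ has the congruence extension property: for every $\mathbf B\in\mathcal{SPSI}$, every subalgebra $\mathbf A$ of $\mathbf B$ and every congruence $\delta$ of $\mathbf A$ there is a congruence $\theta$ of $\mathbf B$ with $\delta=\theta\cap A^2$. (2) $\mathcal{SPSI}$ has equationally definable principal congruences: there is a finite conjunction $\zeta(x,y,u,v)$ of equations between terms such that for every $\mathbf A\in\mathcal{SPSI}$ and all $a,b,c,d\in A$, the pair $(c,d)$ lies in the smallest congruence of $\mathbf A$ containing $(a,b)$ if and only if $\mathbf A\models\zeta[a,b,c,d]$. (3) $\mathcal{SPSI}$ is arithmetical: for every $\mathbf A\in\mathcal{SPSI}$ the lattice of congruences of $\mathbf A$ is distributive, and any two congruences of $\mathbf A$ permute, that is, $\theta\circ\varphi=\varphi\circ\theta$. -/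

import Mathlib

universe u

/-! ### Universal algebra: congruences, CEP, EDPC, arithmeticity

Algebras are structures for a first-order language without relation symbols; classes of algebras
are sets of bundled structures. -/

namespace UnivAlg

/-- A congruence of the algebra `A`: an equivalence relation compatible with all basic
operations. -/
@[ext]
structure Congruence (L : FirstOrder.Language.{0, 0}) (A : Type u) [L.Structure A] extends Setoid A where
  compatible : ∀ {n : ℕ} (f : L.Functions n) (x y : Fin n → A),
    (∀ i, toSetoid (x i) (y i)) → toSetoid (FirstOrder.Language.Structure.funMap f x) (FirstOrder.Language.Structure.funMap f y)

namespace Congruence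

variable {L : FirstOrder.Language.{0, 0}} {A : Type u} [L.Structure A]

theorem toSetoid_injective :
    Function.Injective (toSetoid : Congruence L A → Setoid A) := by
  rintro ⟨r, _⟩ ⟨s, _⟩ h
  cases h
  rfl

/-- Congruences are ordered by inclusion. -/
instance : PartialOrder (Congruence L A) :=
  PartialOrder.lift toSetoid toSetoid_injective

/-- The infimum of a set of congruences is their intersection. -/
instance : InfSet (Congruence L A) where
  sInf S :=
    { toSetoid := sInf (toSetoid '' S)
      compatible := by
        rintro n f x y h _ ⟨θ, hθ, rfl⟩
        exact θ.compatible f x y fun i => h i _ ⟨θ, hθ, rfl⟩ }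

theorem isGLB_sInf (S : Set (Congruence L A)) : IsGLB S (sInf S) := by
  constructor
  · intro θ hθ x y h
    exact h _ ⟨θ, hθ, rfl⟩
  · rintro φ hφ x y h _ ⟨θ, hθ, rfl⟩
    exact hφ hθ h

/-- The congruence lattice of `A`. -/
instance : CompleteLattice (Congruence L A) :=
  completeLatticeOfInf _ isGLB_sInf

/-- The principal congruence `Cg(a, b)`: the smallest congruence containing `(a, b)`. -/
def principal (L : FirstOrder.Language.{0, 0}) {A : Type u} [L.Structure A] (a b : A) : Congruence L A :=
  sInf {θ | θ.toSetoid a b}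

end Congruence

variable {L : FirstOrder.Language.{0, 0}}

/-- The congruence extension property: every congruence `δ` of a subalgebra `S` of a member `B`
is the restriction `θ ∩ S²` of a congruence `θ` of `B`. -/
def HasCEP (V : Set (CategoryTheory.Bundled.{u} L.Structure)) : Prop :=
  ∀ B ∈ V, ∀ S : L.Substructure B, ∀ δ : Congruence L S,
    ∃ θ : Congruence L B, ∀ x y : S, δ.toSetoid x y ↔ θ.toSetoid (x : B) (y : B)

/-- Equationally definable principal congruences: one finite conjunction of equations in four
variables defines `(c, d) ∈ Cg(a, b)` in all members of the class. -/
def HasEDPC (V : Set (CategoryTheory.Bundled.{u} L.Structure)) : Prop :=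
  ∃ E : List (L.Term (Fin 4) × L.Term (Fin 4)), ∀ A ∈ V, ∀ a b c d : A,
    (Congruence.principal L a b).toSetoid c d ↔
      ∀ e ∈ E, e.1.realize ![a, b, c, d] = e.2.realize ![a, b, c, d]

/-- All congruence lattices of members of the class are distributive. -/
def IsCongruenceDistributive (V : Set (CategoryTheory.Bundled.{u} L.Structure)) : Prop :=
  ∀ A ∈ V, ∀ θ φ ψ : Congruence L A, θ ⊓ (φ ⊔ ψ) = (θ ⊓ φ) ⊔ (θ ⊓ ψ)

/-- Any two congruences of a member of the class permute: `θ ∘ φ = φ ∘ θ`. -/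
def IsCongruencePermutable (V : Set (CategoryTheory.Bundled.{u} L.Structure)) : Prop :=
  ∀ A ∈ V, ∀ θ φ : Congruence L A,
    Relation.Comp (⇑θ.toSetoid) (⇑φ.toSetoid) = Relation.Comp (⇑φ.toSetoid) (⇑θ.toSetoid)

/-- Arithmetical: congruence distributive and congruence permutable. -/
def IsArithmetical (V : Set (CategoryTheory.Bundled.{u} L.Structure)) : Prop :=
  IsCongruenceDistributive V ∧ IsCongruencePermutable V

end UnivAlg

/-! ### Strict pseudo-inference algebras -/

/-- A Boolean algebra with a ternary weakly normal monotonic operator. -/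
class ThreeBAMO (A : Type u) extends BooleanAlgebra A where
  dia : A → A → A → A
  dia_bot_left : ∀ b c : A, dia ⊥ b c = ⊥
  dia_bot_mid : ∀ a c : A, dia a ⊥ c = ⊥
  dia_bot_right : ∀ a b : A, dia a b ⊥ = ⊥
  dia_sup_left : ∀ a x b c : A, dia (a ⊔ x) b c = dia a b c ⊔ dia x b c
  dia_sup_mid : ∀ a b x c : A, dia a (b ⊔ x) c = dia a b c ⊔ dia a x c
  dia_sup_right : ∀ a b c x : A, dia a b c ⊔ dia a b x ≤ dia a b (c ⊔ x)

/-- A pseudo-inference algebra. -/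
class PSIAlgebra (A : Type u) extends ThreeBAMO A where
  pi1 : ∀ a b d e f : A, dia a b f ≤ dia a b dᶜ ⊔ dia a b eᶜ ⊔ dia d e f
  pi2 : ∀ a b : A, dia a b aᶜ = ⊥
  pi3 : ∀ a f : A, a ⊓ f ≤ dia a a f
  pi4 : ∀ a b f : A, dia a b f ≤ dia b a f

/-- The operator `μ(z) = ¬◇(1,1,¬z) ∧ ¬◇(1,¬z,1)`. -/
def ThreeBAMO.mu {A : Type u} [ThreeBAMO A] (z : A) : A :=
  (dia ⊤ ⊤ zᶜ)ᶜ ⊓ (dia ⊤ zᶜ ⊤)ᶜ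

/-- A strict pseudo-inference algebra. -/
class StrictPSIAlgebra (A : Type u) extends PSIAlgebra A where
  r1 : ∀ x y a b : A, dia x y a ⊓ (dia x y b)ᶜ ≤ dia ⊤ ⊤ (a ⊓ bᶜ)
  r2 : ∀ x y a b : A, dia x a y ⊓ (dia x b y)ᶜ ≤ dia ⊤ (a ⊓ bᶜ) ⊤
  s : ∀ a b c : A, dia a b c ≤ ThreeBAMO.mu (dia a b c)

/-- The operation symbols `∨, ∧, ¬, 0, 1, ◇` with their arities. -/
inductive PSIOp : ℕ → Type
  | sup : PSIOp 2
  | inf : PSIOp 2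
  | neg : PSIOp 1
  | bot : PSIOp 0
  | top : PSIOp 0
  | dia : PSIOp 3

/-- The algebraic language of pseudo-inference algebras. -/
def psiLanguage : FirstOrder.Language.{0, 0} where
  Functions := PSIOp
  Relations := fun _ => Empty

/-- The algebra `(A, ∨, ∧, ¬, 0, 1, ◇)` as a structure for the language. -/
@[reducible]
def psiStructure (A : Type u) [ThreeBAMO A] : psiLanguage.Structure A where
  funMap := fun {_} f => match f with
    | PSIOp.sup => fun v => v 0 ⊔ v 1
    | PSIOp.inf => fun v => v 0 ⊓ v 1
    | PSIOp.neg => fun v => (v 0)ᶜ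
    | PSIOp.bot => fun _ => ⊥
    | PSIOp.top => fun _ => ⊤
    | PSIOp.dia => fun v => ThreeBAMO.dia (v 0) (v 1) (v 2)
  RelMap := fun r => r.elim

/-- The variety `SPSI` of strict pseudo-inference algebras. -/
def SPSI : Set (CategoryTheory.Bundled.{u} psiLanguage.Structure) :=
  {A | ∃ _ : StrictPSIAlgebra A, A.str = psiStructure A}

/-!
Congruences of these algebras are Boolean filters closed under `μ`: `θ` corresponds to the class of
`⊤`, and `(a, b) ∈ θ` says that `a ⇔ b` lies in that class. The axioms make `μ` an `S5` necessity
operator, and `r1`, `r2` and the symmetry of `◇` say that `◇` respects agreement below `f` up to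
`μ f`. Hence `Cg(a, b)` corresponds to the filter of all elements above `μ (a ⇔ b)`, which gives the
equation `μ (a ⇔ b) ⊓ (c ⇔ d) = μ (a ⇔ b)` for EDPC, and the filter of a congruence of a subalgebra
generates a filter of the whole algebra with the same trace on the subalgebra. Arithmeticity only
needs a Pixley term, which every Boolean algebra has.
-/

open FirstOrder.Language (Term Substructure Structure)
open FirstOrder.Language.HomClass (realize_term)
open scoped symmDiff FirstOrder

/-! ### Congruences and Pixley terms -/

namespace UnivAlg

variable {L : FirstOrder.Language.{0, 0}} {A : Type u} [L.Structure A]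

namespace Congruence

theorem rel_realize (θ : Congruence L A) {α : Type*} (t : L.Term α) {v w : α → A}
    (h : ∀ i, θ.toSetoid (v i) (w i)) : θ.toSetoid (t.realize v) (t.realize w) := by
  induction t with
  | var i => exact h i
  | func f ts ih => exact θ.compatible f _ _ ih

theorem rel_realize_three (θ : Congruence L A) (t : L.Term (Fin 3)) {a b c a' b' c' : A}
    (ha : θ.toSetoid a a') (hb : θ.toSetoid b b') (hc : θ.toSetoid c c') :
    θ.toSetoid (t.realize ![a, b, c]) (t.realize ![a', b', c']) :=
  θ.rel_realize t fun i => by fin_cases i; exacts [ha, hb, hc]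

theorem principal_rel_iff {a b c d : A} :
    (principal L a b).toSetoid c d ↔ ∀ θ : Congruence L A, θ.toSetoid a b → θ.toSetoid c d :=
  ⟨fun h θ hθ => h _ ⟨θ, hθ, rfl⟩, by rintro h _ ⟨θ, hθ, rfl⟩; exact h θ hθ⟩

theorem principal_le_iff {a b : A} {θ : Congruence L A} :
    principal L a b ≤ θ ↔ θ.toSetoid a b :=
  ⟨fun h => h (principal_rel_iff.2 fun _ => id), fun h _ _ hcd => principal_rel_iff.1 hcd θ h⟩

theorem inf_rel_iff {θ φ : Congruence L A} {a b : A} :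
    (θ ⊓ φ).toSetoid a b ↔ θ.toSetoid a b ∧ φ.toSetoid a b := by
  simp only [← principal_le_iff, le_inf_iff]

end Congruence

theorem rel_funMap_of_rel_funMap_update (s : Setoid A) {n : ℕ} (f : L.Functions n)
    (h : ∀ (x : Fin n → A) (i : Fin n) (a b : A), s a b →
      s (Structure.funMap f (Function.update x i a)) (Structure.funMap f (Function.update x i b)))
    {x y : Fin n → A} (hxy : ∀ i, s (x i) (y i)) :
    s (Structure.funMap f x) (Structure.funMap f y) := by
  have replace_on (T : Finset (Fin n)) :
      s (Structure.funMap f x) (Structure.funMap f (T.piecewise y x)) := by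
    induction T using Finset.induction_on with
    | empty => simpa only [Finset.piecewise_empty] using s.refl _
    | insert i T hi ih =>
      refine s.trans ih ?_
      have step := h (T.piecewise y x) i (x i) (y i) (hxy i)
      rwa [← Finset.piecewise_insert, ← Finset.piecewise_eq_of_notMem T y x hi,
        Function.update_eq_self] at step
  simpa only [Finset.piecewise_univ] using replace_on Finset.univ

namespace Congruence

theorem toSetoid_sup (θ φ : Congruence L A) :
    (θ ⊔ φ).toSetoid = θ.toSetoid ⊔ φ.toSetoid := by
  let η : Congruence L A :=
    { toSetoid := θ.toSetoid ⊔ φ.toSetoid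
      compatible := fun f x y hxy => by
        refine rel_funMap_of_rel_funMap_update _ f (fun x i a b hab => ?_) hxy
        let translation (c : A) : A := Structure.funMap f (Function.update x i c)
        have translate (ψ : Congruence L A) (hψ : ψ.toSetoid ≤ θ.toSetoid ⊔ φ.toSetoid) :
            ψ.toSetoid ≤ (θ.toSetoid ⊔ φ.toSetoid).comap translation := fun c d hcd =>
          hψ <| ψ.compatible f _ _ fun j => by
            obtain rfl | hj := eq_or_ne j i
            · simpa only [Function.update_self] using hcd
            · simpa only [Function.update_of_ne hj] using ψ.refl _
        exact sup_le (translate θ le_sup_left) (translate φ le_sup_right) hab }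
  refine le_antisymm ?_ (sup_le (le_sup_left : θ ≤ θ ⊔ φ) (le_sup_right : φ ≤ θ ⊔ φ))
  have hθ : θ ≤ η := (le_sup_left : θ.toSetoid ≤ θ.toSetoid ⊔ φ.toSetoid)
  have hφ : φ ≤ η := (le_sup_right : φ.toSetoid ≤ θ.toSetoid ⊔ φ.toSetoid)
  exact sup_le hθ hφ

end Congruence

/-- `p` is a Pixley term on `A`: it satisfies `p(x, y, y) = x`, `p(x, x, y) = y` and
`p(x, y, x) = x`. -/
structure IsPixleyTerm (p : L.Term (Fin 3)) (A : Type u) [L.Structure A] : Prop where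
  realize_right (x y : A) : p.realize ![x, y, y] = x
  realize_left (x y : A) : p.realize ![x, x, y] = y
  realize_outer (x y : A) : p.realize ![x, y, x] = x

namespace IsPixleyTerm

variable {p : L.Term (Fin 3)} (hp : IsPixleyTerm p A)
include hp

theorem comp_le_comp (θ φ : Congruence L A) :
    Relation.Comp (⇑θ.toSetoid) (⇑φ.toSetoid) ≤ Relation.Comp (⇑φ.toSetoid) (⇑θ.toSetoid) := by
  rintro x z ⟨y, hxy, hyz⟩
  refine ⟨p.realize ![x, y, z], ?_, ?_⟩
  · simpa only [hp.realize_right] using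
      φ.rel_realize_three p (φ.refl x) (φ.symm hyz) (φ.refl z)
  · simpa only [hp.realize_left] using θ.rel_realize_three p hxy (θ.refl y) (θ.refl z)

theorem comp_comm (θ φ : Congruence L A) :
    Relation.Comp (⇑θ.toSetoid) (⇑φ.toSetoid) = Relation.Comp (⇑φ.toSetoid) (⇑θ.toSetoid) :=
  le_antisymm (hp.comp_le_comp θ φ) (hp.comp_le_comp φ θ)

theorem inf_sup_left (θ φ ψ : Congruence L A) : θ ⊓ (φ ⊔ ψ) = θ ⊓ φ ⊔ θ ⊓ ψ := by
  refine le_antisymm (fun a b hab => ?_) le_inf_sup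
  obtain ⟨hθ, hsup⟩ := Congruence.inf_rel_iff.1 hab
  -- `p(x, p(x, y, z), z)` is a majority term
  let m (x : A) : A := p.realize ![a, p.realize ![a, x, b], b]
  have m_left : m a = a := by simp only [m, hp.realize_left, hp.realize_right]
  have m_right : m b = b := by simp only [m, hp.realize_left, hp.realize_right]
  have m_rel (η : Congruence L A) {x y : A} (h : η.toSetoid x y) : η.toSetoid (m x) (m y) :=
    η.rel_realize_three p (η.refl a) (η.rel_realize_three p (η.refl a) h (η.refl b)) (η.refl b)
  have m_rel_left (x : A) : θ.toSetoid (m x) a := by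
    simpa only [m, hp.realize_outer] using
      θ.rel_realize_three p (θ.refl a) (θ.refl (p.realize ![a, x, b])) (θ.symm hθ)
  have le_comap (η : Congruence L A) (hη : θ ⊓ η ≤ θ ⊓ φ ⊔ θ ⊓ ψ) :
      η.toSetoid ≤ (θ ⊓ φ ⊔ θ ⊓ ψ).toSetoid.comap m := fun x y h =>
    hη <| Congruence.inf_rel_iff.2 ⟨θ.trans (m_rel_left x) (θ.symm (m_rel_left y)), m_rel η h⟩
  rw [Congruence.toSetoid_sup] at hsup
  have m_rel_m := sup_le (le_comap φ le_sup_left) (le_comap ψ le_sup_right) hsup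
  rwa [Setoid.comap_rel, m_left, m_right] at m_rel_m

end IsPixleyTerm

theorem isArithmetical_of_isPixleyTerm {V : Set (CategoryTheory.Bundled.{u} L.Structure)}
    {p : L.Term (Fin 3)} (hp : ∀ A ∈ V, IsPixleyTerm p A) : IsArithmetical V :=
  ⟨fun A hA => (hp A hA).inf_sup_left, fun A hA => (hp A hA).comp_comm⟩

end UnivAlg

/-! ### Terms -/

attribute [local instance] psiStructure

namespace PSITerm

variable {α : Type}

/-- The term `s ∨ t`. -/
def sup (s t : psiLanguage.Term α) : psiLanguage.Term α :=
  .func (l := 2) PSIOp.sup ![s, t]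

/-- The term `s ∧ t`. -/
def inf (s t : psiLanguage.Term α) : psiLanguage.Term α :=
  .func (l := 2) PSIOp.inf ![s, t]

/-- The term `¬t`. -/
def compl (t : psiLanguage.Term α) : psiLanguage.Term α :=
  .func (l := 1) PSIOp.neg ![t]

/-- The term `1`. -/
def top : psiLanguage.Term α :=
  .func (l := 0) PSIOp.top ![]

/-- The term `◇(r, s, t)`. -/
def dia (r s t : psiLanguage.Term α) : psiLanguage.Term α :=
  .func (l := 3) PSIOp.dia ![r, s, t]

/-- The Boolean equivalence of two terms. -/
def bihimp (s t : psiLanguage.Term α) : psiLanguage.Term α :=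
  sup (inf s t) (inf (compl s) (compl t))

/-- The term `μ(t)`. -/
def mu (t : psiLanguage.Term α) : psiLanguage.Term α :=
  inf (compl (dia top top (compl t))) (compl (dia top (compl t) top))

/-- The Pixley term `(x ∧ z) ∨ (¬y ∧ (x ∨ z))` of Boolean algebras. -/
def pixley : psiLanguage.Term (Fin 3) :=
  sup (inf (.var 0) (.var 2)) (inf (compl (.var 1)) (sup (.var 0) (.var 2)))

variable {A : Type u} [ThreeBAMO A] (v : α → A) (s t : psiLanguage.Term α)

@[simp]
theorem realize_inf : (inf s t).realize v = s.realize v ⊓ t.realize v := rfl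

@[simp]
theorem realize_mu : (mu t).realize v = ThreeBAMO.mu (t.realize v) := rfl

@[simp]
theorem realize_bihimp : (bihimp s t).realize v = s.realize v ⇔ t.realize v :=
  (bihimp_eq' _ _).symm

theorem isPixleyTerm_pixley : UnivAlg.IsPixleyTerm pixley A where
  realize_right x y := by
    change x ⊓ y ⊔ yᶜ ⊓ (x ⊔ y) = x
    rw [inf_sup_left, compl_inf_self, sup_bot_eq, inf_comm yᶜ, sup_inf_inf_compl]
  realize_left x y := by
    change x ⊓ y ⊔ xᶜ ⊓ (x ⊔ y) = y
    rw [inf_sup_left, compl_inf_self, bot_sup_eq, inf_comm x, inf_comm xᶜ, sup_inf_inf_compl]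
  realize_outer x y := by
    change x ⊓ x ⊔ yᶜ ⊓ (x ⊔ x) = x
    rw [inf_idem, sup_idem, inf_comm, sup_inf_self]

end PSITerm

/-! ### Congruences and filters closed under `μ` -/

namespace ThreeBAMO

open UnivAlg

variable {A B : Type u} [ThreeBAMO A] [ThreeBAMO B]

theorem dia_mono_mid (a c : A) : Monotone fun b => dia a b c := fun b b' h => by
  simpa only [dia_sup_mid, sup_eq_right] using congrArg (dia a · c) (sup_eq_right.2 h)

theorem dia_mono_right (a b : A) : Monotone (dia a b) := fun c c' h => by
  simpa only [sup_eq_right.2 h] using le_sup_left.trans (dia_sup_right a b c c')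

theorem mu_mono : Monotone (mu : A → A) := fun _ _ h =>
  inf_le_inf (compl_le_compl (dia_mono_right _ _ (compl_le_compl h)))
    (compl_le_compl (dia_mono_mid _ _ (compl_le_compl h)))

theorem mu_top : mu (⊤ : A) = ⊤ := by
  simp only [mu, compl_top, dia_bot_right, dia_bot_mid, compl_bot, inf_top_eq]

theorem compl_mu (z : A) : (mu z)ᶜ = dia ⊤ ⊤ zᶜ ⊔ dia ⊤ zᶜ ⊤ := by
  simp only [mu, compl_inf, compl_compl]

section Hom

variable (h : A →[psiLanguage] B)

theorem map_inf (a b : A) : h (a ⊓ b) = h a ⊓ h b :=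
  h.map_fun (n := 2) PSIOp.inf ![a, b]

theorem map_mu (a : A) : h (mu a) = mu (h a) :=
  (realize_term h (t := PSITerm.mu (.var 0)) (v := ![a])).symm

theorem map_bihimp (a b : A) : h (a ⇔ b) = h a ⇔ h b := by
  simpa using (realize_term h (t := PSITerm.bihimp (.var 0) (.var 1)) (v := ![a, b])).symm

end Hom

section Congruence

variable (θ : Congruence psiLanguage A) {a b a' b' : A}

theorem rel_sup (ha : θ.toSetoid a a') (hb : θ.toSetoid b b') :
    θ.toSetoid (a ⊔ b) (a' ⊔ b') :=
  θ.compatible (n := 2) PSIOp.sup ![a, b] ![a', b'] (Fin.forall_fin_two.2 ⟨ha, hb⟩)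

theorem rel_inf (ha : θ.toSetoid a a') (hb : θ.toSetoid b b') :
    θ.toSetoid (a ⊓ b) (a' ⊓ b') :=
  θ.compatible (n := 2) PSIOp.inf ![a, b] ![a', b'] (Fin.forall_fin_two.2 ⟨ha, hb⟩)

theorem rel_mu (ha : θ.toSetoid a a') : θ.toSetoid (mu a) (mu a') :=
  θ.rel_realize (PSITerm.mu (.var 0)) (v := ![a]) (w := ![a']) (Fin.forall_fin_one.2 ha)

theorem rel_bihimp (ha : θ.toSetoid a a') (hb : θ.toSetoid b b') :
    θ.toSetoid (a ⇔ b) (a' ⇔ b') := by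
  simpa using θ.rel_realize (PSITerm.bihimp (.var 0) (.var 1)) (v := ![a, b]) (w := ![a', b'])
    (Fin.forall_fin_two.2 ⟨ha, hb⟩)

theorem rel_iff_bihimp_rel_top : θ.toSetoid a b ↔ θ.toSetoid (a ⇔ b) ⊤ :=
  ⟨fun h => by simpa only [bihimp_self] using rel_bihimp θ h (θ.refl b),
    fun h => by
      simpa only [bihimp_bihimp_cancel_right, top_bihimp] using rel_bihimp θ h (θ.refl b)⟩

end Congruence

/-- A `μ`-filter: a filter of the Boolean reduct closed under `μ`. These are the classes of `⊤`
under congruences. -/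
structure MuFilter (A : Type u) [ThreeBAMO A] extends Order.PFilter A where
  mu_mem' : ∀ f ∈ toPFilter, mu f ∈ toPFilter

namespace MuFilter

instance : Membership A (MuFilter A) := ⟨fun F a => a ∈ F.toPFilter⟩

variable {F : MuFilter A} {f g : A}

theorem top_mem : ⊤ ∈ F := Order.PFilter.top_mem (F := F.toPFilter)

theorem inf_mem (hf : f ∈ F) (hg : g ∈ F) : f ⊓ g ∈ F :=
  Order.PFilter.inf_mem (F := F.toPFilter) hf hg

theorem mem_of_le (h : f ≤ g) (hf : f ∈ F) : g ∈ F :=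
  Order.PFilter.mem_of_le (F := F.toPFilter) h hf

theorem mu_mem (hf : f ∈ F) : mu f ∈ F := F.mu_mem' f hf

/-- The `μ`-filter on a set closed under finite meets, `μ` and passing to larger elements. -/
def ofSet (F : Set A) (top_mem : ⊤ ∈ F) (inf_mem : ∀ f ∈ F, ∀ g ∈ F, f ⊓ g ∈ F)
    (mem_of_le : ∀ f g : A, f ≤ g → f ∈ F → g ∈ F) (mu_mem : ∀ f ∈ F, mu f ∈ F) : MuFilter A where
  toPFilter := (Order.IsPFilter.of_def (F := F) ⟨⊤, top_mem⟩
    (fun f hf g hg => ⟨f ⊓ g, inf_mem f hf g hg, inf_le_left, inf_le_right⟩)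
    (fun h => mem_of_le _ _ h)).toPFilter
  mu_mem' := mu_mem

/-- The class of `⊤` under a congruence. -/
def ofCongruence (θ : Congruence psiLanguage A) : MuFilter A :=
  ofSet {f | θ.toSetoid f ⊤} (θ.refl ⊤)
    (fun f hf g hg => by simpa only [Set.mem_ofPred_eq, inf_top_eq] using rel_inf θ hf hg)
    (fun f g h hf => by
      simpa only [Set.mem_ofPred_eq, sup_eq_right.2 h, top_sup_eq] using rel_sup θ hf (θ.refl g))
    (fun f hf => by simpa only [Set.mem_ofPred_eq, mu_top] using rel_mu θ hf)

/-- The `μ`-filter generated by the image of a `μ`-filter under a homomorphism. -/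
def map (h : A →[psiLanguage] B) (F : MuFilter A) : MuFilter B :=
  ofSet {g | ∃ f ∈ F, h f ≤ g} ⟨⊤, top_mem, le_top⟩
    (fun _ ⟨f, hf, hfg⟩ _ ⟨f', hf', hfg'⟩ =>
      ⟨f ⊓ f', inf_mem hf hf', (map_inf h f f').trans_le (inf_le_inf hfg hfg')⟩)
    (fun _ _ hle ⟨f, hf, hfg⟩ => ⟨f, hf, hfg.trans hle⟩)
    (fun _ ⟨f, hf, hfg⟩ => ⟨mu f, mu_mem hf, (map_mu h f).trans_le (mu_mono hfg)⟩)

theorem map_mem_map_iff (h : A ↪[psiLanguage] B) : h f ∈ F.map h.toHom ↔ f ∈ F := by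
  refine ⟨fun ⟨g, hg, hle⟩ => mem_of_le ?_ hg, fun hf => ⟨f, hf, le_rfl⟩⟩
  rw [← inf_eq_left] at hle ⊢
  exact h.injective ((map_inf h.toHom g f).trans hle)

end MuFilter

end ThreeBAMO

/-! ### The axioms of strictness -/

/-- The axioms of strict pseudo-inference algebras other than `pi1` and `pi2`, under which the
congruences correspond to the filters closed under `μ`. -/
class IsStrictPrePSI (A : Type u) [ThreeBAMO A] : Prop where
  pi3 : ∀ a f : A, a ⊓ f ≤ ThreeBAMO.dia a a f
  pi4 : ∀ a b f : A, ThreeBAMO.dia a b f ≤ ThreeBAMO.dia b a f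
  r1 : ∀ x y a b : A,
    ThreeBAMO.dia x y a ⊓ (ThreeBAMO.dia x y b)ᶜ ≤ ThreeBAMO.dia ⊤ ⊤ (a ⊓ bᶜ)
  r2 : ∀ x y a b : A,
    ThreeBAMO.dia x a y ⊓ (ThreeBAMO.dia x b y)ᶜ ≤ ThreeBAMO.dia ⊤ (a ⊓ bᶜ) ⊤
  s : ∀ a b c : A, ThreeBAMO.dia a b c ≤ ThreeBAMO.mu (ThreeBAMO.dia a b c)

instance {A : Type u} [StrictPSIAlgebra A] : IsStrictPrePSI A where
  pi3 := PSIAlgebra.pi3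
  pi4 := PSIAlgebra.pi4
  r1 := StrictPSIAlgebra.r1
  r2 := StrictPSIAlgebra.r2
  s := StrictPSIAlgebra.s

namespace IsStrictPrePSI

open ThreeBAMO UnivAlg

variable {A : Type u} [ThreeBAMO A] [IsStrictPrePSI A]

theorem mu_le (z : A) : mu z ≤ z := by
  have le_dia : zᶜ ≤ dia ⊤ ⊤ zᶜ := by simpa only [top_inf_eq] using pi3 ⊤ zᶜ
  exact inf_le_left.trans (compl_le_iff_compl_le.1 le_dia)

theorem compl_mu_le_mu_compl_mu (z : A) : (mu z)ᶜ ≤ mu (mu z)ᶜ := by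
  rw [compl_mu]
  exact sup_le ((s _ _ _).trans (mu_mono le_sup_left)) ((s _ _ _).trans (mu_mono le_sup_right))

theorem mu_le_mu_mu (z : A) : mu z ≤ mu (mu z) :=
  calc mu z ≤ (mu (mu z)ᶜ)ᶜ := le_compl_comm.1 (mu_le _)
    _ ≤ mu (mu (mu z)ᶜ)ᶜ := compl_mu_le_mu_compl_mu _
    _ ≤ mu (mu z) := mu_mono (compl_le_iff_compl_le.1 (compl_mu_le_mu_compl_mu z))

theorem mu_himp_le_right (x y a b : A) : mu (a ⇨ b) ≤ dia x y a ⇨ dia x y b := by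
  refine inf_le_left.trans (compl_le_iff_compl_le.1 ?_)
  simpa only [compl_himp, sdiff_eq] using r1 x y a b

theorem mu_himp_le_mid (x y a b : A) : mu (a ⇨ b) ≤ dia x a y ⇨ dia x b y := by
  refine inf_le_right.trans (compl_le_iff_compl_le.1 ?_)
  simpa only [compl_himp, sdiff_eq] using r2 x y a b

theorem dia_comm (a b c : A) : dia a b c = dia b a c :=
  le_antisymm (pi4 a b c) (pi4 b a c)

theorem mu_himp_le_left (x y a b : A) : mu (a ⇨ b) ≤ dia a x y ⇨ dia b x y := by
  simpa only [dia_comm] using mu_himp_le_mid x y a b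

theorem mu_le_dia_himp_dia {f a b c a' b' c' : A} (ha : f ≤ a ⇨ a') (hb : f ≤ b ⇨ b')
    (hc : f ≤ c ⇨ c') : mu f ≤ dia a b c ⇨ dia a' b' c' :=
  calc mu f ≤ (dia a b c ⇨ dia a' b c) ⊓ (dia a' b c ⇨ dia a' b' c) ⊓
        (dia a' b' c ⇨ dia a' b' c') :=
        le_inf (le_inf ((mu_mono ha).trans (mu_himp_le_left _ _ _ _))
          ((mu_mono hb).trans (mu_himp_le_mid _ _ _ _)))
          ((mu_mono hc).trans (mu_himp_le_right _ _ _ _))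
    _ ≤ (dia a b c ⇨ dia a' b' c) ⊓ (dia a' b' c ⇨ dia a' b' c') :=
        inf_le_inf_right _ (himp_triangle _ _ _)
    _ ≤ dia a b c ⇨ dia a' b' c' := himp_triangle _ _ _

theorem mu_le_dia_bihimp_dia {f a b c a' b' c' : A} (ha : f ≤ a ⇔ a') (hb : f ≤ b ⇔ b')
    (hc : f ≤ c ⇔ c') : mu f ≤ dia a b c ⇔ dia a' b' c' :=
  le_inf
    (mu_le_dia_himp_dia (ha.trans inf_le_left) (hb.trans inf_le_left) (hc.trans inf_le_left))
    (mu_le_dia_himp_dia (ha.trans inf_le_right) (hb.trans inf_le_right) (hc.trans inf_le_right))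

end IsStrictPrePSI

theorem bihimp_trans_le {A : Type*} [GeneralizedHeytingAlgebra A] (a b c : A) :
    (a ⇔ b) ⊓ (b ⇔ c) ≤ a ⇔ c :=
  le_inf (inf_comm (a ⇔ b) _ ▸ (inf_le_inf inf_le_left inf_le_left).trans (himp_triangle c b a))
    ((inf_le_inf inf_le_right inf_le_right).trans (himp_triangle a b c))

theorem bihimp_inf_bihimp_le_inf_bihimp_inf {A : Type*} [GeneralizedHeytingAlgebra A]
    (a a' b b' : A) : (a ⇔ a') ⊓ (b ⇔ b') ≤ (a ⊓ b) ⇔ (a' ⊓ b') := by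
  have detach (x y : A) : y ⊓ (x ⇔ y) ≤ x ∧ x ⊓ (x ⇔ y) ≤ y := le_bihimp_iff.1 le_rfl
  exact le_bihimp_iff.2
    ⟨(inf_inf_inf_comm _ _ _ _).trans_le (inf_le_inf (detach a a').1 (detach b b').1),
      (inf_inf_inf_comm _ _ _ _).trans_le (inf_le_inf (detach a a').2 (detach b b').2)⟩

theorem bihimp_inf_bihimp_le_sup_bihimp_sup {A : Type*} [BooleanAlgebra A] (a a' b b' : A) :
    (a ⇔ a') ⊓ (b ⇔ b') ≤ (a ⊔ b) ⇔ (a' ⊔ b') := by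
  simpa only [← compl_sup, compl_bihimp_compl] using
    bihimp_inf_bihimp_le_inf_bihimp_inf aᶜ a'ᶜ bᶜ b'ᶜ

namespace ThreeBAMO.MuFilter

open IsStrictPrePSI UnivAlg

variable {A : Type u} [ThreeBAMO A] [IsStrictPrePSI A]

/-- The congruence of a `μ`-filter: two elements are related when the filter contains their Boolean
equivalence. -/
def congruence (F : MuFilter A) : Congruence psiLanguage A where
  r a b := a ⇔ b ∈ F
  iseqv :=
    { refl a := (bihimp_self a).symm ▸ top_mem
      symm {a b} h := bihimp_comm a b ▸ h
      trans h h' := mem_of_le (bihimp_trans_le _ _ _) (inf_mem h h') }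
  compatible f x y h := by
    cases f with
    | sup => exact mem_of_le (bihimp_inf_bihimp_le_sup_bihimp_sup _ _ _ _) (inf_mem (h 0) (h 1))
    | inf => exact mem_of_le (bihimp_inf_bihimp_le_inf_bihimp_inf _ _ _ _) (inf_mem (h 0) (h 1))
    | neg => exact (compl_bihimp_compl (x 0) (y 0)).symm ▸ h 0
    | bot => exact (bihimp_self (⊥ : A)).symm ▸ top_mem
    | top => exact (bihimp_self (⊤ : A)).symm ▸ top_mem
    | dia =>
      refine mem_of_le (mu_le_dia_bihimp_dia ?_ ?_ ?_)
        (mu_mem (inf_mem (inf_mem (h 0) (h 1)) (h 2)))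
      exacts [inf_le_left.trans inf_le_left, inf_le_left.trans inf_le_right, inf_le_right]

/-- The `μ`-filter generated by `z`, which consists of the elements above `μ z`. -/
def principal (z : A) : MuFilter A where
  toPFilter := .principal (mu z)
  mu_mem' _ hf := (mu_le_mu_mu z).trans (mu_mono hf)

end ThreeBAMO.MuFilter

namespace IsStrictPrePSI

open ThreeBAMO UnivAlg

variable {A B : Type u} [ThreeBAMO A] [ThreeBAMO B]

theorem principal_rel_iff [IsStrictPrePSI A] (a b c d : A) :
    (Congruence.principal psiLanguage a b).toSetoid c d ↔ mu (a ⇔ b) ≤ c ⇔ d := by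
  rw [Congruence.principal_rel_iff]
  constructor
  · intro h
    exact h (MuFilter.principal (a ⇔ b)).congruence (mu_le (a ⇔ b))
  · intro h θ hab
    have mu_mem : mu (a ⇔ b) ∈ MuFilter.ofCongruence θ :=
      MuFilter.mu_mem ((rel_iff_bihimp_rel_top θ).1 hab)
    exact (rel_iff_bihimp_rel_top θ).2 (MuFilter.mem_of_le h mu_mem)

theorem exists_congruence_extension [IsStrictPrePSI B] (h : A ↪[psiLanguage] B)
    (δ : Congruence psiLanguage A) :
    ∃ θ : Congruence psiLanguage B, ∀ x y : A, δ.toSetoid x y ↔ θ.toSetoid (h x) (h y) := by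
  refine ⟨((MuFilter.ofCongruence δ).map h.toHom).congruence, fun x y => ?_⟩
  calc δ.toSetoid x y ↔ x ⇔ y ∈ MuFilter.ofCongruence δ := rel_iff_bihimp_rel_top δ
    _ ↔ h (x ⇔ y) ∈ (MuFilter.ofCongruence δ).map h.toHom := (MuFilter.map_mem_map_iff h).symm
    _ ↔ h x ⇔ h y ∈ (MuFilter.ofCongruence δ).map h.toHom :=
      iff_of_eq (congrArg (· ∈ _) (map_bihimp h.toHom x y))

end IsStrictPrePSI

namespace ThreeBAMO

variable {A : Type u} [ThreeBAMO A] (S : psiLanguage.Substructure A)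

/-- The Boolean reduct of a subalgebra. -/
def booleanSubalgebra : BooleanSubalgebra A where
  carrier := S
  supClosed' a ha b hb := S.fun_mem (n := 2) PSIOp.sup ![a, b] (Fin.forall_fin_two.2 ⟨ha, hb⟩)
  infClosed' a ha b hb := S.fun_mem (n := 2) PSIOp.inf ![a, b] (Fin.forall_fin_two.2 ⟨ha, hb⟩)
  compl_mem' {a} ha := S.fun_mem (n := 1) PSIOp.neg ![a] (Fin.forall_fin_one.2 ha)
  bot_mem' := S.fun_mem (n := 0) PSIOp.bot ![] finZeroElim

theorem dia_mem {a b c : A} (ha : a ∈ S) (hb : b ∈ S) (hc : c ∈ S) : dia a b c ∈ S :=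
  S.fun_mem (n := 3) PSIOp.dia ![a, b, c] fun i => by fin_cases i; exacts [ha, hb, hc]

/-- The operations of `A` restricted to a subalgebra. -/
abbrev ofSubstructure : ThreeBAMO S where
  toBooleanAlgebra := inferInstanceAs (BooleanAlgebra (booleanSubalgebra S))
  dia a b c := ⟨dia a b c, dia_mem S a.2 b.2 c.2⟩
  dia_bot_left _ _ := Subtype.ext (dia_bot_left _ _)
  dia_bot_mid _ _ := Subtype.ext (dia_bot_mid _ _)
  dia_bot_right _ _ := Subtype.ext (dia_bot_right _ _)
  dia_sup_left _ _ _ _ := Subtype.ext (dia_sup_left _ _ _ _)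
  dia_sup_mid _ _ _ _ := Subtype.ext (dia_sup_mid _ _ _ _)
  dia_sup_right a b c x := dia_sup_right (a : A) b c x

theorem isStrictPrePSI_ofSubstructure [IsStrictPrePSI A] :
    @IsStrictPrePSI S (ofSubstructure S) :=
  letI := ofSubstructure S
  { pi3 a f := IsStrictPrePSI.pi3 (a : A) f
    pi4 a b f := IsStrictPrePSI.pi4 (a : A) b f
    r1 x y a b := IsStrictPrePSI.r1 (x : A) y a b
    r2 x y a b := IsStrictPrePSI.r2 (x : A) y a b
    s a b c := IsStrictPrePSI.s (a : A) b c }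

theorem inducedStructure_eq_psiStructure :
    (Substructure.inducedStructure : psiLanguage.Structure S) =
      @psiStructure S (ofSubstructure S) := by
  ext n f x
  · cases f <;> rfl
  · exact f.elim

end ThreeBAMO

/-- The variety of Boolean algebras with a ternary operation that satisfies the axioms of strict
pseudo-inference algebras other than `pi1` and `pi2`. -/
def StrictPrePSI : Set (CategoryTheory.Bundled.{u} psiLanguage.Structure) :=
  {A | ∃ _ : ThreeBAMO A, IsStrictPrePSI A ∧ A.str = psiStructure A}

namespace StrictPrePSI

theorem forall_mem {P : CategoryTheory.Bundled.{u} psiLanguage.Structure → Prop}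
    (h : ∀ (A : Type u) [ThreeBAMO A] [IsStrictPrePSI A], P ⟨A, psiStructure A⟩) :
    ∀ A ∈ StrictPrePSI, P A := by
  rintro ⟨A, str⟩ ⟨inst, hA, hstr⟩
  change ThreeBAMO A at inst
  obtain rfl : str = psiStructure A := hstr
  exact h A

theorem substructure_mem : ∀ A ∈ StrictPrePSI.{u}, ∀ S : psiLanguage.Substructure A,
    (⟨S, inferInstance⟩ : CategoryTheory.Bundled psiLanguage.Structure) ∈ StrictPrePSI := by
  refine forall_mem fun A _ _ => ?_
  intro S
  exact ⟨ThreeBAMO.ofSubstructure S, ThreeBAMO.isStrictPrePSI_ofSubstructure S,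
    ThreeBAMO.inducedStructure_eq_psiStructure S⟩

theorem hasCEP : UnivAlg.HasCEP StrictPrePSI.{u} := by
  have extend : ∀ A ∈ StrictPrePSI.{u}, ∀ B ∈ StrictPrePSI.{u}, ∀ (h : A ↪[psiLanguage] B)
      (δ : UnivAlg.Congruence psiLanguage A), ∃ θ : UnivAlg.Congruence psiLanguage B,
        ∀ x y : A, δ.toSetoid x y ↔ θ.toSetoid (h x) (h y) :=
    forall_mem fun A _ _ => forall_mem fun B _ _ => IsStrictPrePSI.exists_congruence_extension
  exact fun B hB S => extend ⟨S, inferInstance⟩ (substructure_mem B hB S) B hB S.subtype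

theorem hasEDPC : UnivAlg.HasEDPC StrictPrePSI.{u} := by
  let m : psiLanguage.Term (Fin 4) := PSITerm.mu (PSITerm.bihimp (.var 0) (.var 1))
  refine ⟨[(PSITerm.inf m (PSITerm.bihimp (.var 2) (.var 3)), m)], forall_mem fun A _ _ => ?_⟩
  intro a b c d
  simp [m, IsStrictPrePSI.principal_rel_iff]

theorem isArithmetical : UnivAlg.IsArithmetical StrictPrePSI.{u} :=
  UnivAlg.isArithmetical_of_isPixleyTerm (forall_mem fun _ => PSITerm.isPixleyTerm_pixley)

end StrictPrePSI

theorem SPSI_subset_strictPrePSI : SPSI.{u} ⊆ StrictPrePSI := fun _ ⟨_, hA⟩ =>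
  ⟨inferInstance, inferInstance, hA⟩

theorem mainTheorem6_general : UnivAlg.HasCEP StrictPrePSI.{u} ∧
    UnivAlg.HasEDPC StrictPrePSI.{u} ∧ UnivAlg.IsArithmetical StrictPrePSI.{u} :=
  ⟨StrictPrePSI.hasCEP, StrictPrePSI.hasEDPC, StrictPrePSI.isArithmetical⟩

theorem mainTheorem6 :
    UnivAlg.HasCEP SPSI.{u} ∧ UnivAlg.HasEDPC SPSI.{u} ∧ UnivAlg.IsArithmetical SPSI.{u} := by
  obtain ⟨hCEP, ⟨E, hE⟩, hdist, hperm⟩ := mainTheorem6_general.{u}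
  have mem {A} (hA : A ∈ SPSI.{u}) := SPSI_subset_strictPrePSI hA
  exact ⟨fun B hB => hCEP B (mem hB), ⟨E, fun A hA => hE A (mem hA)⟩,
    fun A hA => hdist A (mem hA), fun A hA => hperm A (mem hA)⟩
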